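/- For integers $m\ge 0$, $n\ge 1$, a matrix $A\in\mathbb{R}^{m\times n}$ and $C>0$, let $\|A\|_{1\to\infty}=\sup_{\|x\|_1\le 1}\|Ax\|_\infty$ $(=\max_{i,j}|a_{ij}|)$, $$\Gamma_{A,C}=\Bigl\{x\in\mathbb{R}^n:\ \|Ax\|_\infty\le C\sqrt{n\log(m/n+2)}\ \text{ and }\ \|x\|_\infty\le 1\Bigr\},$$ $$\mathrm{OPT}_A(C)=\frac{1}{\sqrt n}\,\mathbb{E}_{g\sim\mathcal N(0,I_n)}\Bigl[\max_{y\in\Gamma_{A,C}}\langle g,y\rangle\Bigr].$$ For every $C>0$ there is a constant $\delta'_C>0$, depending only on $C$ (in particular not on $m$, $n$ or $A$), with $\delta'_C\to 0$ as $C\to\infty$, such that for all $m\ge 0$, $n\ge 1$, all $A\in\mathbb{R}^{m\times n}$ with $\|A\|_{1\to\infty}\le 1$ and all $C>0$, $$\mathrm{OPT}_A(C)\ \ge\ \sqrt{2n/\pi}-\delta'_C\sqrt n.$$ -/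

import Mathlib

open MeasureTheory ProbabilityTheory Filter Topology

namespace SpencerLP

/-- The norm `‖A‖_{1→∞}` of a real matrix: the supremum of `‖A x‖_∞` over the `ℓ¹` unit ball.
(The norm of `Fin m → ℝ` is the sup norm.) -/
noncomputable def normOneInfty {m n : ℕ} (A : Matrix (Fin m) (Fin n) ℝ) : ℝ :=
  sSup {r : ℝ | ∃ x : Fin n → ℝ, ∑ j, |x j| ≤ 1 ∧ r = ‖A.mulVec x‖}

/-- The convex body `Γ_{A,C}` of all `x ∈ [-1,1]ⁿ` with
`‖A x‖_∞ ≤ C √(n log (m/n + 2))`; the norms are sup norms. -/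
def Gam {m n : ℕ} (A : Matrix (Fin m) (Fin n) ℝ) (C : ℝ) : Set (Fin n → ℝ) :=
  {x | ‖A.mulVec x‖ ≤ C * √((n : ℝ) * Real.log ((m : ℝ) / (n : ℝ) + 2)) ∧ ‖x‖ ≤ 1}

/-- The value `max_{y ∈ Γ_{A,C}} ⟨g, y⟩` of the linear program. -/
noncomputable def lpMax {m n : ℕ} (A : Matrix (Fin m) (Fin n) ℝ) (C : ℝ) (g : Fin n → ℝ) : ℝ :=
  sSup ((fun y : Fin n → ℝ => ∑ j, g j * y j) '' Gam A C)

/-- The standard Gaussian law `N(0, I_n)` on `ℝⁿ`. -/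
noncomputable def gauss (n : ℕ) : Measure (Fin n → ℝ) :=
  Measure.pi fun _ => gaussianReal 0 1

/-- `OPT_A(C) = 𝔼_{g ∼ N(0, I_n)} [max_{y ∈ Γ_{A,C}} ⟨g, y⟩] / √n`. -/
noncomputable def OPT {m n : ℕ} (A : Matrix (Fin m) (Fin n) ℝ) (C : ℝ) : ℝ :=
  (∫ g, lpMax A C g ∂(gauss n)) / √(n : ℝ)

/-- The condition `‖A‖_{1→∞} ≤ 1` says that all entries have absolute value at most one. -/
theorem normOneInfty_le_one_iff {m n : ℕ} (A : Matrix (Fin m) (Fin n) ℝ) :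
    normOneInfty A ≤ 1 ↔ ∀ i j, |A i j| ≤ 1 := by
  have bound : ∀ K : ℝ, 0 ≤ K → (∀ i j, |A i j| ≤ K) → ∀ x : Fin n → ℝ, ∑ j, |x j| ≤ 1 →
      ‖A.mulVec x‖ ≤ K := by
    intro K hK hA x hx
    rw [pi_norm_le_iff_of_nonneg hK]
    intro i
    calc ‖A.mulVec x i‖ = |∑ j, A i j * x j| := rfl
      _ ≤ ∑ j, |A i j * x j| := Finset.abs_sum_le_sum_abs _ _
      _ ≤ ∑ j, K * |x j| := by
          refine Finset.sum_le_sum fun j _ => ?_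
          rw [abs_mul]
          exact mul_le_mul_of_nonneg_right (hA i j) (abs_nonneg _)
      _ = K * ∑ j, |x j| := by rw [Finset.mul_sum]
      _ ≤ K := mul_le_of_le_one_right hK hx
  constructor
  · intro h i j
    have hb : BddAbove {r : ℝ | ∃ x : Fin n → ℝ, ∑ j, |x j| ≤ 1 ∧ r = ‖A.mulVec x‖} := by
      refine ⟨∑ i, ∑ j, |A i j|, ?_⟩
      rintro r ⟨x, hx, rfl⟩
      refine bound _ (by positivity) (fun i j => ?_) x hx
      calc |A i j| ≤ ∑ j, |A i j| :=
            Finset.single_le_sum (f := fun j => |A i j|) (fun _ _ => abs_nonneg _)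
              (Finset.mem_univ j)
        _ ≤ _ := Finset.single_le_sum (f := fun i => ∑ j, |A i j|)
              (fun _ _ => by positivity) (Finset.mem_univ i)
    have h1 : ‖A.mulVec (Pi.single j 1)‖ ≤ normOneInfty A := by
      refine le_csSup hb ⟨Pi.single j 1, ?_, rfl⟩
      rw [Finset.sum_eq_single j] <;> simp +contextual
    have h2 := norm_le_pi_norm (A.mulVec (Pi.single j 1)) i
    simp only [Matrix.mulVec_single_one, Matrix.col_apply, Real.norm_eq_abs] at h1 h2
    linarith
  · intro hA
    refine csSup_le ⟨_, 0, by simp, rfl⟩ ?_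
    rintro r ⟨x, hx, rfl⟩
    exact bound 1 zero_le_one hA x hx

/-- For `C ≥ 0` the maximum in `lpMax` is attained. -/
theorem lpMax_isGreatest {m n : ℕ} (A : Matrix (Fin m) (Fin n) ℝ) {C : ℝ} (hC : 0 ≤ C)
    (g : Fin n → ℝ) :
    IsGreatest ((fun y : Fin n → ℝ => ∑ j, g j * y j) '' Gam A C) (lpMax A C g) := by
  have hcl : IsClosed (Gam A C) := by
    have hc : Continuous fun x : Fin n → ℝ => A.mulVec x := by fun_prop
    exact (isClosed_le hc.norm continuous_const).inter
      (isClosed_le continuous_norm continuous_const)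
  have hK : IsCompact (Gam A C) := by
    refine (isCompact_closedBall (0 : Fin n → ℝ) 1).of_isClosed_subset hcl fun x hx => ?_
    simpa using hx.2
  have hne : (Gam A C).Nonempty := by
    refine ⟨0, ?_, by simp⟩
    simp only [Matrix.mulVec_zero, norm_zero]
    positivity
  exact (hK.image (by fun_prop)).isGreatest_sSup (hne.image _)

/-- For `C ≥ 0` the expectation in `OPT` exists. -/
theorem integrable_lpMax {m n : ℕ} (A : Matrix (Fin m) (Fin n) ℝ) {C : ℝ} (hC : 0 ≤ C) :
    Integrable (lpMax A C) (gauss n) := by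
  have key : ∀ (g h y : Fin n → ℝ), y ∈ Gam A C →
      ∑ j, g j * y j ≤ ∑ j, h j * y j + ∑ j, |g j - h j| := by
    intro g h y hy
    rw [← Finset.sum_add_distrib]
    refine Finset.sum_le_sum fun j _ => ?_
    have h1 : |y j| ≤ 1 := (norm_le_pi_norm y j).trans hy.2
    have h2 : (g j - h j) * y j ≤ |g j - h j| := by
      refine (le_abs_self _).trans ?_
      rw [abs_mul]
      exact mul_le_of_le_one_right (abs_nonneg _) h1
    linarith
  have lip : ∀ g h : Fin n → ℝ, lpMax A C g ≤ lpMax A C h + ∑ j, |g j - h j| := by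
    intro g h
    obtain ⟨y, hy, hg⟩ := (lpMax_isGreatest A hC g).1
    have h2 := (lpMax_isGreatest A hC h).2 ⟨y, hy, rfl⟩
    have h3 := key g h y hy
    simp only at hg h2
    linarith
  have hcont : Continuous (lpMax A C) := by
    rw [continuous_iff_continuousAt]
    intro h
    have ht : Tendsto (fun g : Fin n → ℝ => ∑ j, |g j - h j|) (𝓝 h) (𝓝 0) := by
      have hc : Continuous fun g : Fin n → ℝ => ∑ j, |g j - h j| := by fun_prop
      simpa using hc.tendsto h
    rw [ContinuousAt, tendsto_iff_norm_sub_tendsto_zero]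
    refine squeeze_zero (fun _ => norm_nonneg _) (fun g => ?_) ht
    rw [Real.norm_eq_abs, abs_sub_le_iff]
    have h1 := lip g h
    have h2 := lip h g
    simp only [abs_sub_comm (h _)] at h2
    constructor <;> linarith
  have hzero : lpMax A C 0 = 0 := by
    obtain ⟨y, _, hy⟩ := (lpMax_isGreatest A hC 0).1
    simpa using hy.symm
  have hsum : Integrable (fun g : Fin n → ℝ => ∑ j, |g j|) (gauss n) := by
    refine integrable_finsetSum _ fun j _ => ?_
    have hid : Integrable (fun x : ℝ => |x|) (gaussianReal 0 1) :=
      ((memLp_one_iff_integrable.mp (memLp_id_gaussianReal' 1 (by simp)))).abs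
    exact integrable_comp_eval (μ := fun _ : Fin n => gaussianReal 0 1) (i := j) hid
  refine hsum.mono' hcont.aestronglyMeasurable (Eventually.of_forall fun g => ?_)
  have h1 := lip g 0
  have h2 := lip 0 g
  simp only [Pi.zero_apply, sub_zero, zero_sub, abs_neg, hzero] at h1 h2
  rw [Real.norm_eq_abs, abs_le]
  constructor <;> linarith

end SpencerLP

namespace SpencerLP

/-! With `L = C √(n log (m/n + 2))`, duality (`exists_dual`) bounds the maximum below, up to `ε`, by
`‖g - Aᵀl‖₁ + L‖l‖₁` for some `l` depending on `g`. For a fixed `v`, `‖g - v‖₁` has mean at least `n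
√(2/π)`, so the point is uniformity over `l`. Only an `ℓ¹` ball of vectors `l` matters. The rows of
`A` have Euclidean norm at most `√n`, so Maurey's lemma approximates each such `Aᵀl` by a rescaled
average of `k` signed rows (`exists_net`). The logarithm in `L` shrinks that ball enough for a `k`
with few multisets (`log_card_sym_le`). A union bound over this net, using a Laplace transform
estimate uniform in the centre (`integral_exp_neg_mul_abs_sub_le`), gives
`le_integral_lpMax_of_net`. With `C = p ^ 4` every error term is `O(n / p)`. -/

theorem mul_sign_eq_abs (a : ℝ) : a * Real.sign a = |a| := by
  rcases lt_trichotomy a 0 with h | h | h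
  · rw [Real.sign_of_neg h, abs_of_neg h]; ring
  · simp [h]
  · rw [Real.sign_of_pos h, abs_of_pos h]; ring

theorem abs_sign_le_one (a : ℝ) : |Real.sign a| ≤ 1 := by
  rcases Real.sign_apply_eq a with h | h | h <;> simp [h]

/-! ### Linear programming duality -/

/-- Weak form of linear programming duality: an upper bound for the primal program is witnessed by
a dual vector. -/
theorem exists_dual {m n : ℕ} (A : Matrix (Fin m) (Fin n) ℝ) {L c : ℝ} (hL : 0 ≤ L)
    (g : Fin n → ℝ)
    (h : ∀ y : Fin n → ℝ, ‖A.mulVec y‖ ≤ L → ‖y‖ ≤ 1 → ∑ j, g j * y j < c) :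
    ∃ l : Fin m → ℝ, ∑ j, |g j - ∑ i, l i * A i j| + L * ∑ i, |l i| ≤ c := by
  classical
  have hc : 0 < c := by simpa using h 0 (by simpa using hL) (by simp)
  let F : (Fin n → ℝ) →ₗ[ℝ] ℝ × (Fin m → ℝ) :=
    { toFun := fun y => (∑ j, g j * y j, A.mulVec y)
      map_add' := fun x y => by
        simp [Matrix.mulVec_add, mul_add, Finset.sum_add_distrib]
      map_smul' := fun r x => by
        simp [Matrix.mulVec_smul, Finset.mul_sum, mul_left_comm] }
  have hF : Continuous F := LinearMap.continuous_of_finiteDimensional F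
  -- Separate the image of the cube under `y ↦ (⟨g, y⟩, A y)` from `[c, ∞)` times the `L`-ball; the
  -- coefficients of the functional, normalised by `-a`, form the dual vector.
  obtain ⟨f, u, v, hu, huv, hv⟩ := geometric_hahn_banach_compact_closed
    (s := F '' Metric.closedBall 0 1) (t := Set.Ici c ×ˢ Metric.closedBall (0 : Fin m → ℝ) L)
    ((convex_closedBall 0 1).linear_image F)
    ((isCompact_closedBall 0 1).image hF)
    ((convex_Ici c).prod (convex_closedBall 0 L))
    (isClosed_Ici.prod Metric.isClosed_closedBall)
    (by
      rw [Set.disjoint_left]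
      rintro _ ⟨y, hy, rfl⟩ ⟨h1, h2⟩
      have := h y (by simpa [F] using h2) (by simpa using hy)
      exact absurd this (not_lt.2 h1))
  set a : ℝ := f (1, 0) with ha
  set l : Fin m → ℝ := fun i => f (0, Pi.single i 1) with hl
  have hf : ∀ (s : ℝ) (z : Fin m → ℝ), f (s, z) = a * s + ∑ i, l i * z i := by
    intro s z
    have hz : (s, z) = s • ((1 : ℝ), (0 : Fin m → ℝ))
        + ∑ i, z i • ((0 : ℝ), (Pi.single i 1 : Fin m → ℝ)) := by
      refine Prod.ext ?_ ?_
      · simp [Prod.fst_sum]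
      · ext i
        simp [Prod.snd_sum, Finset.sum_apply, Pi.single_apply]
    rw [hz, map_add, map_sum, map_smul]
    simp only [map_smul, smul_eq_mul, ha, hl]
    rw [mul_comm]
    congr 1
    exact Finset.sum_congr rfl fun i _ => mul_comm _ _
  have h1 : ∑ j, |a * g j + ∑ i, l i * A i j| < u := by
    let y : Fin n → ℝ := fun j => Real.sign (a * g j + ∑ i, l i * A i j)
    have hy := hu (F y) ⟨y, by
      simpa [pi_norm_le_iff_of_nonneg] using fun j => abs_sign_le_one _, rfl⟩
    have : f (F y) = ∑ j, |a * g j + ∑ i, l i * A i j| := by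
      change f (∑ j, g j * y j, A.mulVec y) = _
      rw [hf]
      simp_rw [← mul_sign_eq_abs, Matrix.mulVec, dotProduct, add_mul, Finset.sum_add_distrib,
        Finset.mul_sum, Finset.sum_mul]
      rw [Finset.sum_comm]
      simp [y, mul_assoc]
    linarith
  have h2 : v < a * c - L * ∑ i, |l i| := by
    have hz := hv (c, fun i => -L * Real.sign (l i)) ⟨Set.mem_Ici.2 le_rfl, by
      rw [mem_closedBall_zero_iff, pi_norm_le_iff_of_nonneg hL]
      intro i
      rw [Real.norm_eq_abs, abs_mul, abs_neg, abs_of_nonneg hL]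
      exact mul_le_of_le_one_right hL (abs_sign_le_one _)⟩
    rw [hf] at hz
    have : ∑ i, l i * (-L * Real.sign (l i)) = - (L * ∑ i, |l i|) := by
      rw [Finset.mul_sum, ← Finset.sum_neg_distrib]
      exact Finset.sum_congr rfl fun i _ => by rw [← mul_sign_eq_abs]; ring
    linarith
  have h3 : ∑ j, |a * g j + ∑ i, l i * A i j| + L * ∑ i, |l i| < a * c := by linarith
  have ha0 : 0 < a := by
    have : 0 < a * c := lt_of_le_of_lt (by positivity) h3
    exact pos_of_mul_pos_left this hc.le
  refine ⟨fun i => -(l i / a), ?_⟩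
  have h4 : ∀ j, |g j - ∑ i, -(l i / a) * A i j| = |a * g j + ∑ i, l i * A i j| / a := by
    intro j
    nth_rewrite 3 [← abs_of_pos ha0]
    rw [← abs_div]
    congr 1
    rw [add_div, mul_div_cancel_left₀ _ ha0.ne', Finset.sum_div, sub_eq_add_neg,
      ← Finset.sum_neg_distrib]
    congr 1
    exact Finset.sum_congr rfl fun i _ => by ring
  have h5 : ∀ i, |-(l i / a)| = |l i| / a := fun i => by rw [abs_neg, abs_div, abs_of_pos ha0]
  simp_rw [h4, h5]
  rw [← Finset.sum_div, ← Finset.sum_div, ← mul_div_assoc, ← add_div, div_le_iff₀ ha0]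
  linarith

/-! ### Maurey's lemma -/

/-- The family `0, ± a i`. -/
def signedFamily {E : Type*} [NormedAddCommGroup E] {ι : Type*} (a : ι → E) : Option (ι × Bool) → E
  | none => 0
  | some (i, true) => a i
  | some (i, false) => -a i

section Maurey

variable {E : Type*} [NormedAddCommGroup E] [InnerProductSpace ℝ E]

/-- Greedy form of Maurey's lemma: a point of the convex hull of a bounded family is approximated
by averages of `k` members of the family. -/
theorem exists_sym_norm_sub_sq_le {ι : Type*} {w : ι → E} {B : ℝ} (hw : ∀ i, ‖w i‖ ≤ B) {x : E}
    (hx : x ∈ convexHull ℝ (Set.range w)) (k : ℕ) :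
    ∃ s : Sym ι k, ‖((s : Multiset ι).map w).sum - (k : ℝ) • x‖ ^ 2 ≤ k * (2 * B) ^ 2 := by
  have hxB : ‖x‖ ≤ B := by
    obtain ⟨_, ⟨i, rfl⟩, hi⟩ := (convexOn_univ_norm (E := E)).exists_ge_of_mem_convexHull
      (Set.subset_univ _) hx
    exact hi.trans (hw i)
  induction k with
  | zero => exact ⟨Sym.nil, by simp⟩
  | succ k ih =>
    obtain ⟨s, hs⟩ := ih
    set d := ((s : Multiset ι).map w).sum - (k : ℝ) • x with hd
    -- Some member has inner product with the current error `d` no larger than `x` does. Adding it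
    -- makes the cross term nonpositive, so the squared error grows by at most `(2 * B) ^ 2`.
    have hlin : ConcaveOn ℝ Set.univ (innerSL ℝ d) :=
      (innerSL ℝ d).toLinearMap.concaveOn convex_univ
    obtain ⟨_, ⟨i, rfl⟩, hi⟩ := hlin.exists_le_of_mem_convexHull (Set.subset_univ _) hx
    refine ⟨i ::ₛ s, ?_⟩
    have hsum : (((i ::ₛ s : Sym ι (k + 1)) : Multiset ι).map w).sum - ((k + 1 : ℕ) : ℝ) • x
        = d + (w i - x) := by
      rw [Sym.coe_cons, Multiset.map_cons, Multiset.sum_cons, hd]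
      push_cast
      rw [add_smul, one_smul]
      abel
    rw [hsum, norm_add_sq_real, inner_sub_right]
    have h1 : inner ℝ d (w i) ≤ inner ℝ d x := by simpa using hi
    have h2 : ‖w i - x‖ ≤ 2 * B := (norm_sub_le _ _).trans (by linarith [hw i])
    have h3 : ‖w i - x‖ ^ 2 ≤ (2 * B) ^ 2 := pow_le_pow_left₀ (norm_nonneg _) h2 2
    push_cast
    nlinarith

/-- Put weight `|l i|` on `sign (l i) • a i`; the zero member absorbs the missing mass `1 - ∑ |l
i|`. -/
theorem sum_smul_mem_convexHull_signedFamily {ι : Type*} [Fintype ι] (a : ι → E) {l : ι → ℝ}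
    (hl : ∑ i, |l i| ≤ 1) : ∑ i, l i • a i ∈ convexHull ℝ (Set.range (signedFamily a)) := by
  have hmem : ∀ o : Option ι, (o.elim 0 fun i => Real.sign (l i) • a i) ∈
      convexHull ℝ (Set.range (signedFamily a)) := by
    intro o
    refine subset_convexHull ℝ _ ?_
    rcases o with _ | i
    · exact ⟨none, rfl⟩
    · rcases Real.sign_apply_eq (l i) with h | h | h
      · exact ⟨some (i, false), by simp [signedFamily, h]⟩
      · exact ⟨none, by simp [signedFamily, h]⟩
      · exact ⟨some (i, true), by simp [signedFamily, h]⟩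
  have := (convex_convexHull ℝ (Set.range (signedFamily a))).sum_mem (t := Finset.univ)
    (w := fun o : Option ι => o.elim (1 - ∑ i, |l i|) fun i => |l i|)
    (z := fun o : Option ι => o.elim 0 fun i => Real.sign (l i) • a i)
    (by rintro (_ | i) _ <;> simp [hl]) (by simp [Fintype.sum_option]) (fun o _ => hmem o)
  rw [Fintype.sum_option] at this
  simp only [Option.elim_none, smul_zero, zero_add, Option.elim_some, smul_smul] at this
  convert this using 3 with i
  rw [← mul_sign_eq_abs, mul_assoc]
  rcases lt_trichotomy (l i) 0 with h | h | h
  · simp [Real.sign_of_neg h]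
  · simp [h]
  · simp [Real.sign_of_pos h]

end Maurey

theorem norm_signedFamily_le {E : Type*} [NormedAddCommGroup E] {ι : Type*} {a : ι → E} {B : ℝ} (hB : 0 ≤ B) (ha : ∀ i, ‖a i‖ ≤ B)
    (o : Option (ι × Bool)) : ‖signedFamily a o‖ ≤ B := by
  rcases o with _ | ⟨i, _ | _⟩ <;> simp [signedFamily, hB, ha]

/-! ### One-dimensional Gaussian estimates -/

theorem integrable_abs_gaussianReal : Integrable (fun x : ℝ => |x|) (gaussianReal 0 1) :=
  (memLp_one_iff_integrable.mp (memLp_id_gaussianReal' 1 (by simp))).abs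

theorem integrable_sq_gaussianReal : Integrable (fun x : ℝ => x ^ 2) (gaussianReal 0 1) :=
  (memLp_id_gaussianReal' 2 (by simp)).integrable_sq

theorem integral_sq_gaussianReal : ∫ x, x ^ 2 ∂(gaussianReal 0 1) = 1 := by
  have h := variance_fun_id_gaussianReal (μ := 0) (v := 1)
  rw [variance_eq_integral (by fun_prop)] at h
  simpa using h

theorem integral_abs_gaussianReal :
    ∫ x, |x| ∂(gaussianReal 0 1) = √(2 / Real.pi) := by
  rw [integral_gaussianReal_eq_integral_smul one_ne_zero]
  have h1 : ∀ x : ℝ, gaussianPDFReal 0 1 x • |x|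
      = (√(2 * Real.pi))⁻¹ * (|x| ^ (1 : ℝ) * Real.exp (-(1 / 2) * |x| ^ (2 : ℝ))) := by
    intro x
    rw [gaussianPDFReal]
    norm_num
    ring_nf
  simp_rw [h1]
  rw [integral_const_mul, integral_comp_abs (f := fun x : ℝ => x ^ (1 : ℝ) *
    Real.exp (-(1 / 2) * x ^ (2 : ℝ))),
    integral_rpow_mul_exp_neg_mul_rpow (by norm_num) (by norm_num) (by norm_num)]
  norm_num
  rw [div_eq_mul_inv (√2), mul_assoc, mul_comm]
  congr 1
  rw [inv_mul_eq_div, Real.div_sqrt]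

/-- Since `(1 - x + x²/2)(1 + x + x²/2) = 1 + x⁴/4 ≥ 1`, the quadratic lower bound for `exp x`
inverts. -/
theorem exp_neg_le_quadratic {x : ℝ} (hx : 0 ≤ x) : Real.exp (-x) ≤ 1 - x + x ^ 2 / 2 := by
  have h1 := Real.quadratic_le_exp_of_nonneg hx
  have h2 : Real.exp (-x) * Real.exp x = 1 := by rw [← Real.exp_add]; simp
  have h3 := Real.exp_pos (-x)
  have h4 : 0 < 1 - x + x ^ 2 / 2 := by nlinarith [sq_nonneg (x - 1)]
  have h5 : 1 ≤ (1 - x + x ^ 2 / 2) * (1 + x + x ^ 2 / 2) := by nlinarith [sq_nonneg (x ^ 2)]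
  have h6 : Real.exp (-x) * (1 + x + x ^ 2 / 2) ≤ 1 := by
    exact (mul_le_mul_of_nonneg_left h1 h3.le).trans_eq h2
  have h7 : 0 < 1 + x + x ^ 2 / 2 := by positivity
  exact le_of_mul_le_mul_right (h6.trans h5) h7

theorem integrable_abs_sub_gaussianReal (a : ℝ) :
    Integrable (fun x : ℝ => |x - a|) (gaussianReal 0 1) :=
  ((memLp_one_iff_integrable.mp (memLp_id_gaussianReal' 1 (by simp))).sub
    (integrable_const a)).abs

/-- Symmetrise under `x ↦ -x` and use `|x - a| + |x + a| ≥ 2|x|`. -/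
theorem integral_abs_le_integral_abs_sub (a : ℝ) :
    ∫ x, |x| ∂(gaussianReal 0 1) ≤ ∫ x, |x - a| ∂(gaussianReal 0 1) := by
  have h1 : ∫ x, |x - a| ∂(gaussianReal 0 1) = ∫ x, |x + a| ∂(gaussianReal 0 1) := by
    have h : (gaussianReal 0 1).map (fun x : ℝ => -x) = gaussianReal 0 1 := by
      rw [gaussianReal_map_neg, neg_zero]
    nth_rewrite 1 [← h]
    rw [integral_map (by fun_prop) (by fun_prop)]
    refine integral_congr_ae (Eventually.of_forall fun x => ?_)
    change |-x - a| = |x + a|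
    rw [← abs_neg]; ring_nf
  have hi : Integrable (fun x : ℝ => |x + a|) (gaussianReal 0 1) := by
    simpa using integrable_abs_sub_gaussianReal (-a)
  have h2 : ∫ x, 2 * |x| ∂(gaussianReal 0 1) ≤ ∫ x, (|x - a| + |x + a|) ∂(gaussianReal 0 1) := by
    refine integral_mono (integrable_abs_gaussianReal.const_mul 2)
      ((integrable_abs_sub_gaussianReal a).add hi) fun x => ?_
    have := abs_add_le (x - a) (x + a)
    have h3 : |x - a + (x + a)| = 2 * |x| := by
      rw [show x - a + (x + a) = 2 * x by ring, abs_mul]; simp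
    rwa [h3] at this
  rw [integral_const_mul, integral_add (integrable_abs_sub_gaussianReal a) hi, ← h1] at h2
  linarith

theorem integrable_exp_neg_mul_abs_sub {θ : ℝ} (hθ : 0 ≤ θ) (a : ℝ) :
    Integrable (fun x : ℝ => Real.exp (-θ * |x - a|)) (gaussianReal 0 1) := by
  refine Integrable.of_bound (by fun_prop) 1 (Eventually.of_forall fun x => ?_)
  rw [Real.norm_eq_abs, Real.abs_exp, Real.exp_le_one_iff]
  have := mul_nonneg hθ (abs_nonneg (x - a))
  linarith

/-- The second-order expansion costs `θ² (1 + a²) / 2`, which is at most `θ²` only for `|a| ≤ 1`.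
For `|a| ≥ 1` the linear bound `|x - a| ≥ 1 - sign a * x` and the Gaussian moment generating
function suffice, because `√(2/π) ≤ 1`. -/
theorem integral_exp_neg_mul_abs_sub_le {θ : ℝ} (hθ : 0 ≤ θ) (a : ℝ) :
    ∫ x, Real.exp (-θ * |x - a|) ∂(gaussianReal 0 1)
      ≤ Real.exp (-θ * √(2 / Real.pi) + θ ^ 2) := by
  rcases le_total |a| 1 with ha | ha
  · have ha2 : a ^ 2 ≤ 1 := (sq_le_one_iff_abs_le_one a).2 ha
    have hid : Integrable (fun x : ℝ => x) (gaussianReal 0 1) :=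
      memLp_one_iff_integrable.mp (memLp_id_gaussianReal' 1 (by simp))
    have hsq : Integrable (fun x : ℝ => (x - a) ^ 2) (gaussianReal 0 1) := by
      have := (integrable_sq_gaussianReal.sub (hid.const_mul (2 * a))).add
        (integrable_const (a ^ 2))
      refine this.congr (Eventually.of_forall fun x => ?_)
      simp only [Pi.add_apply, Pi.sub_apply]
      ring
    have hsqi : ∫ x, (x - a) ^ 2 ∂(gaussianReal 0 1) = 1 + a ^ 2 := by
      have : ∀ x : ℝ, (x - a) ^ 2 = x ^ 2 - (2 * a) * x + a ^ 2 := fun x => by ring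
      simp_rw [this]
      have hd : Integrable (fun x : ℝ => x ^ 2 - (2 * a) * x) (gaussianReal 0 1) :=
        integrable_sq_gaussianReal.sub (hid.const_mul (2 * a))
      rw [integral_add hd (integrable_const _), integral_sub integrable_sq_gaussianReal (hid.const_mul (2 * a)),
        integral_const_mul, integral_sq_gaussianReal, integral_id_gaussianReal]
      simp
    have hab := integrable_abs_sub_gaussianReal a
    have h1 : ∫ x, Real.exp (-θ * |x - a|) ∂(gaussianReal 0 1)
        ≤ ∫ x, (1 - θ * |x - a| + θ ^ 2 / 2 * (x - a) ^ 2) ∂(gaussianReal 0 1) := by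
      refine integral_mono (integrable_exp_neg_mul_abs_sub hθ a)
        (((integrable_const 1).sub (hab.const_mul θ)).add (hsq.const_mul _)) fun x => ?_
      have := exp_neg_le_quadratic (mul_nonneg hθ (abs_nonneg (x - a)))
      rw [mul_pow, sq_abs] at this
      simp only [neg_mul]
      linarith
    have hd : Integrable (fun x : ℝ => 1 - θ * |x - a|) (gaussianReal 0 1) :=
      (integrable_const 1).sub (hab.const_mul θ)
    rw [integral_add hd (hsq.const_mul _), integral_sub (integrable_const 1) (hab.const_mul θ), integral_const_mul, integral_const_mul,
      hsqi] at h1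
    have h2 := mul_le_mul_of_nonneg_left (integral_abs_le_integral_abs_sub a) hθ
    rw [integral_abs_gaussianReal] at h2
    have h3 := Real.add_one_le_exp (-θ * √(2 / Real.pi) + θ ^ 2)
    simp only [integral_const, probReal_univ, smul_eq_mul, mul_one] at h1
    nlinarith [sq_nonneg θ]
  · have hmu : √(2 / Real.pi) ≤ 1 := by
      rw [Real.sqrt_le_one, div_le_one Real.pi_pos]
      linarith [Real.pi_gt_three]
    set t : ℝ := θ * Real.sign a
    have ht : t ^ 2 ≤ θ ^ 2 := by
      rw [mul_pow, ← sq_abs (Real.sign a)]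
      refine mul_le_of_le_one_right (sq_nonneg _) (pow_le_one₀ (abs_nonneg _) ?_)
      rcases Real.sign_apply_eq a with h | h | h <;> simp [h]
    have h1 : ∫ x, Real.exp (-θ * |x - a|) ∂(gaussianReal 0 1)
        ≤ ∫ x, Real.exp (-θ) * Real.exp (t * x) ∂(gaussianReal 0 1) := by
      refine integral_mono (integrable_exp_neg_mul_abs_sub hθ a)
        ((integrable_exp_mul_gaussianReal t).const_mul _) fun x => ?_
      simp only
      rw [← Real.exp_add]
      refine Real.exp_le_exp.2 ?_
      have h2 : 1 - Real.sign a * x ≤ |x - a| := by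
        rcases lt_trichotomy a 0 with h | h | h
        · rw [Real.sign_of_neg h]
          rw [abs_of_neg h] at ha
          linarith [le_abs_self (x - a)]
        · norm_num [h] at ha
        · rw [Real.sign_of_pos h]
          rw [abs_of_pos h] at ha
          linarith [neg_abs_le (x - a)]
      have := mul_le_mul_of_nonneg_left h2 hθ
      simp only [t]
      linarith
    have hm : ∫ x, Real.exp (t * x) ∂(gaussianReal 0 1) = Real.exp (t ^ 2 / 2) := by
      have := congrFun (mgf_fun_id_gaussianReal (μ := 0) (v := 1)) t
      simpa [mgf] using this
    rw [integral_const_mul, hm, ← Real.exp_add] at h1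
    refine h1.trans (Real.exp_le_exp.2 ?_)
    nlinarith [sq_nonneg θ, mul_le_mul_of_nonneg_left hmu hθ]

/-! ### Approximation by few rows, and counting -/

theorem exists_sym_average_close {E : Type*} [NormedAddCommGroup E] [InnerProductSpace ℝ E]
    {ι : Type*} [Fintype ι] {a : ι → E} {B R : ℝ} (hB : 0 ≤ B) (hR : 0 < R)
    (ha : ∀ i, ‖a i‖ ≤ B) {l : ι → ℝ} (hl : ∑ i, |l i| ≤ R) (k : ℕ) :
    ∃ s : Sym (Option (ι × Bool)) k,
      ‖∑ i, l i • a i - (R / k) • ((s : Multiset _).map (signedFamily a)).sum‖ ^ 2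
        ≤ 4 * R ^ 2 * B ^ 2 / max (k : ℝ) 1 := by
  have hl' : ∑ i, |l i / R| ≤ 1 := by
    simp_rw [abs_div, abs_of_pos hR]
    rw [← Finset.sum_div]
    exact (div_le_one hR).2 hl
  obtain ⟨s, hs⟩ := exists_sym_norm_sub_sq_le (norm_signedFamily_le hB ha)
    (sum_smul_mem_convexHull_signedFamily a hl') k
  refine ⟨s, ?_⟩
  have hx : ∑ i, l i • a i = R • ∑ i, (l i / R) • a i := by
    rw [Finset.smul_sum]
    refine Finset.sum_congr rfl fun i _ => ?_
    rw [smul_smul, mul_div_cancel₀ _ hR.ne']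
  -- For `k = 0` the approximant is zero (`R / 0 = 0`), and the triangle inequality gives the bound;
  -- hence the `max k 1`.
  rcases Nat.eq_zero_or_pos k with rfl | hk
  · have h1 : ‖∑ i, l i • a i‖ ≤ R * B := by
      calc ‖∑ i, l i • a i‖ ≤ ∑ i, ‖l i • a i‖ := norm_sum_le _ _
        _ ≤ ∑ i, |l i| * B := by
            refine Finset.sum_le_sum fun i _ => ?_
            rw [norm_smul, Real.norm_eq_abs]
            exact mul_le_mul_of_nonneg_left (ha i) (abs_nonneg _)
        _ ≤ R * B := by
            rw [← Finset.sum_mul]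
            exact mul_le_mul_of_nonneg_right hl hB
    have h2 := pow_le_pow_left₀ (norm_nonneg _) h1 2
    simp only [Nat.cast_zero, div_zero, zero_smul, sub_zero, zero_le_one, sup_of_le_right, div_one]
    nlinarith [sq_nonneg (R * B)]
  · have hk' : (0 : ℝ) < k := Nat.cast_pos.2 hk
    have hk1 : (1 : ℝ) ≤ k := Nat.one_le_cast.2 hk
    rw [max_eq_left hk1]
    set S := ((s : Multiset _).map (signedFamily a)).sum
    set x := ∑ i, (l i / R) • a i
    have h1 : R • x - (R / k) • S = -((R / k) • (S - (k : ℝ) • x)) := by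
      rw [smul_sub, smul_smul, div_mul_cancel₀ _ hk'.ne']
      abel
    rw [hx, h1, norm_neg, norm_smul, mul_pow, Real.norm_eq_abs, sq_abs]
    calc (R / k) ^ 2 * ‖S - (k : ℝ) • x‖ ^ 2 ≤ (R / k) ^ 2 * (k * (2 * B) ^ 2) := by gcongr
      _ = 4 * R ^ 2 * B ^ 2 / k := by field_simp; ring

theorem log_choose_le {N k : ℕ} (hk : 0 < k) (hN : k ≤ N) :
    Real.log (N.choose k) ≤ k * (1 + Real.log ((N : ℝ) / k)) := by
  have hk' : (0 : ℝ) < k := Nat.cast_pos.2 hk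
  have hN' : (0 : ℝ) < N := Nat.cast_pos.2 (hk.trans_le hN)
  have h1 : (N.choose k : ℝ) ≤ (Real.exp 1 * (N / k)) ^ k := by
    refine (Nat.choose_le_pow_div (α := ℝ) k N).trans ?_
    have h2 := Real.pow_div_factorial_le_exp k hk'.le k
    have hf : (0 : ℝ) < k.factorial := Nat.cast_pos.2 k.factorial_pos
    calc (N : ℝ) ^ k / k.factorial = (N / k : ℝ) ^ k * ((k : ℝ) ^ k / k.factorial) := by
          rw [div_pow]; field_simp
      _ ≤ (N / k : ℝ) ^ k * Real.exp k := by gcongr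
      _ = (Real.exp 1 * (N / k)) ^ k := by
          rw [mul_pow, ← Real.exp_nat_mul, mul_one, mul_comm]
  have h0 : (0 : ℝ) < N.choose k := Nat.cast_pos.2 (Nat.choose_pos hN)
  refine (Real.log_le_log h0 h1).trans_eq ?_
  rw [Real.log_pow, Real.log_mul (Real.exp_pos 1).ne' (by positivity), Real.log_exp]

theorem half_le_max_floor {x : ℝ} : x / 2 ≤ max (⌊x⌋₊ : ℝ) 1 := by
  rcases le_total x 2 with h | h
  · exact le_max_of_le_right (by linarith)
  · exact le_max_of_le_left (by linarith [Nat.lt_floor_add_one x])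

theorem half_le_log {ρ : ℝ} (hρ : 0 ≤ ρ) : 1 / 2 ≤ Real.log (ρ + 2) := by
  have := Real.log_le_log (by norm_num : (0 : ℝ) < 2) (by linarith : (2 : ℝ) ≤ ρ + 2)
  linarith [Real.log_two_gt_d9]

/-- There are `(2m + k).choose k` multisets, and `(2m + k) / k` is polynomial in `p` and `m/n + 2`.
So each chosen element costs `O(p² + ℓ)`, while `k ≤ n / (p⁴ ℓ)`. -/
theorem log_card_sym_le (m : ℕ) {n : ℕ} (hn : 0 < n) {p : ℝ} (hp : 1 ≤ p) {k : ℕ}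
    (hk : k = ⌊(n : ℝ) / (p ^ 4 * Real.log ((m : ℝ) / n + 2))⌋₊) :
    Real.log (Fintype.card (Sym (Option (Fin m × Bool)) k)) ≤ 10 * n / p ^ 2 := by
  have hn' : (0 : ℝ) < n := Nat.cast_pos.2 hn
  have hp0 : 0 < p := by linarith
  have hρ : (0 : ℝ) ≤ (m : ℝ) / n := by positivity
  have hl := half_le_log hρ
  have hl2 : Real.log ((m : ℝ) / n + 2) ≤ (m : ℝ) / n + 2 := by
    linarith [Real.log_le_sub_one_of_pos (by linarith : 0 < (m : ℝ) / n + 2)]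
  set ρ : ℝ := (m : ℝ) / n with hρdef
  set ℓ : ℝ := Real.log (ρ + 2) with hℓ
  have hcard : Fintype.card (Sym (Option (Fin m × Bool)) k) = (2 * m + k).choose k := by
    rw [Sym.card_sym_eq_choose]
    congr 1
    simp only [Fintype.card_option, Fintype.card_prod, Fintype.card_fin, Fintype.card_bool]
    omega
  rw [hcard]
  rcases Nat.eq_zero_or_pos k with h0 | h0
  · rw [h0]
    simp only [Nat.choose_zero_right, Nat.cast_one, Real.log_one]
    positivity
  have hk0 : (0 : ℝ) < k := Nat.cast_pos.2 h0
  have hx : 0 ≤ (n : ℝ) / (p ^ 4 * ℓ) := by positivity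
  have hkle : (k : ℝ) ≤ n / (p ^ 4 * ℓ) := hk ▸ Nat.floor_le hx
  have hkge : (n : ℝ) / (p ^ 4 * ℓ) / 2 ≤ k := by
    have := half_le_max_floor (x := (n : ℝ) / (p ^ 4 * ℓ))
    rwa [← hk, max_eq_left (Nat.one_le_cast.2 h0)] at this
  have hratio : ((2 * m + k : ℕ) : ℝ) / k ≤ 4 * p ^ 4 * (ρ + 2) ^ 2 := by
    rw [div_le_iff₀ hk0]
    have h1 : (n : ℝ) ≤ 2 * (p ^ 4 * ℓ) * k := by
      rw [div_div, div_le_iff₀ (by positivity)] at hkge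
      linarith
    have h2 : (m : ℝ) = ρ * n := by rw [hρdef]; field_simp
    have hp4 : 1 ≤ p ^ 4 := one_le_pow₀ hp
    push_cast
    calc 2 * (m : ℝ) + k ≤ 2 * (ρ * (2 * (p ^ 4 * ℓ) * k)) + k := by rw [h2]; gcongr
      _ = (4 * p ^ 4 * (ρ * ℓ) + 1) * k := by ring
      _ ≤ (4 * p ^ 4 * (ρ * (ρ + 2)) + 4 * p ^ 4 * 1) * k := by gcongr; linarith
      _ ≤ 4 * p ^ 4 * (ρ + 2) ^ 2 * k := by
          rw [← mul_add]
          gcongr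
          nlinarith
  have hlog : Real.log (((2 * m + k : ℕ) : ℝ) / k) ≤ 4 * p ^ 2 - 2 + 2 * ℓ := by
    have hpos : 0 < ((2 * m + k : ℕ) : ℝ) / k := by positivity
    refine (Real.log_le_log hpos hratio).trans ?_
    have h4 : 4 * p ^ 4 = (2 * p ^ 2) ^ 2 := by ring
    rw [h4, Real.log_mul (by positivity) (by positivity), Real.log_pow, Real.log_pow]
    have := Real.log_le_sub_one_of_pos (by positivity : 0 < 2 * p ^ 2)
    push_cast
    linarith
  calc Real.log ((2 * m + k).choose k)
      ≤ k * (1 + Real.log (((2 * m + k : ℕ) : ℝ) / k)) := log_choose_le h0 (by omega)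
    _ ≤ k * (4 * p ^ 2 + 2 * ℓ) :=
        mul_le_mul_of_nonneg_left (by linarith) hk0.le
    _ ≤ n / (p ^ 4 * ℓ) * (4 * p ^ 2 + 2 * ℓ) := by gcongr
    -- `ℓ ≥ 1/2` gives `4p² ≤ 8p²ℓ`, and `p ≥ 1` gives `2ℓ ≤ 2p²ℓ`.
    _ ≤ n / (p ^ 4 * ℓ) * (10 * p ^ 2 * ℓ) := by
        gcongr
        nlinarith [one_le_pow₀ hp (n := 2)]
    _ = 10 * n / p ^ 2 := by
        have : 0 < ℓ := by linarith
        field_simp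

/-! ### Gaussian integrals on `ℝⁿ` -/

theorem integrable_sum_exp {n : ℕ} {σ : Type*} [Fintype σ] (v : σ → Fin n → ℝ) {θ : ℝ}
    (hθ : 0 ≤ θ) :
    Integrable (fun g : Fin n → ℝ => ∑ s, Real.exp (-θ * ∑ j, |g j - v s j|)) (gauss n) := by
  refine integrable_finsetSum _ fun s _ => ?_
  simp_rw [Finset.mul_sum, Real.exp_sum]
  exact Integrable.fintype_prod (f := fun j x => Real.exp (-θ * |x - v s j|))
    fun j => integrable_exp_neg_mul_abs_sub hθ _

theorem integral_sum_exp_le {n : ℕ} {σ : Type*} [Fintype σ] (v : σ → Fin n → ℝ) {θ : ℝ}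
    (hθ : 0 ≤ θ) :
    ∫ g, ∑ s, Real.exp (-θ * ∑ j, |g j - v s j|) ∂(gauss n)
      ≤ Fintype.card σ * Real.exp (n * (-θ * √(2 / Real.pi) + θ ^ 2)) := by
  simp_rw [Finset.mul_sum, Real.exp_sum]
  rw [gauss, integral_finsetSum _ fun s _ =>
    Integrable.fintype_prod (f := fun j x => Real.exp (-θ * |x - v s j|))
      fun j => integrable_exp_neg_mul_abs_sub hθ _]
  rw [← nsmul_eq_mul, ← Finset.card_univ]
  refine Finset.sum_le_card_nsmul _ _ _ fun s _ => ?_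
  rw [integral_fintype_prod_eq_prod (fun j x => Real.exp (-θ * |x - v s j|)),
    Real.exp_nat_mul]
  refine (Finset.prod_le_prod (fun j _ => integral_nonneg fun x => (Real.exp_pos _).le)
    fun j _ => integral_exp_neg_mul_abs_sub_le hθ _).trans_eq ?_
  simp

theorem integrable_sum_sq (n : ℕ) :
    Integrable (fun g : Fin n → ℝ => ∑ j, g j ^ 2) (gauss n) :=
  integrable_finsetSum _ fun j _ => integrable_comp_eval (μ := fun _ : Fin n => gaussianReal 0 1)
    (i := j) integrable_sq_gaussianReal

theorem integral_sum_sq (n : ℕ) : ∫ g : Fin n → ℝ, ∑ j, g j ^ 2 ∂(gauss n) = n := by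
  rw [gauss, integral_finsetSum _ fun j _ => integrable_comp_eval
    (μ := fun _ : Fin n => gaussianReal 0 1) (i := j) integrable_sq_gaussianReal]
  have : ∀ j : Fin n, ∫ g : Fin n → ℝ, g j ^ 2 ∂(Measure.pi fun _ => gaussianReal 0 1) = 1 :=
      fun j => by
    rw [integral_comp_eval (μ := fun _ : Fin n => gaussianReal 0 1) (i := j)
      (f := fun x : ℝ => x ^ 2) (by fun_prop), integral_sq_gaussianReal]
  simp [this]

theorem sq_sum_abs_le {n : ℕ} (x : Fin n → ℝ) : (∑ j, |x j|) ^ 2 ≤ n * ∑ j, x j ^ 2 := by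
  simpa using sq_sum_le_card_mul_sum_sq (s := Finset.univ) (f := fun j => |x j|)

/-! ### From a net to a lower bound -/

/-- If the bounded dual vectors are approximated in `ℓ¹` by a finite set, then some point of that
set certifies a lower bound for the linear program. -/
theorem exists_net_point_le_lpMax {m n : ℕ} (A : Matrix (Fin m) (Fin n) ℝ) {C : ℝ} (hC : 0 ≤ C)
    {σ : Type*} (v : σ → Fin n → ℝ) {a e : ℝ} (ha : 0 < a)
    (hv : ∀ l : Fin m → ℝ, C * √((n : ℝ) * Real.log ((m : ℝ) / (n : ℝ) + 2)) * ∑ i, |l i| ≤ a →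
      ∃ s, ∑ j, |∑ i, l i * A i j - v s j| ≤ e) (g : Fin n → ℝ) {ε : ℝ} (hε : 0 < ε) :
    ∃ s, ∑ j, |g j - v s j| ≤ lpMax A C g + ε + e + n / a * ∑ j, g j ^ 2 := by
  have hmax := lpMax_isGreatest A hC g
  have tri : ∀ (x : Fin n → ℝ) s,
      ∑ j, |g j - v s j| ≤ ∑ j, |g j - x j| + ∑ j, |x j - v s j| := by
    intro x s
    rw [← Finset.sum_add_distrib]
    exact Finset.sum_le_sum fun j _ => abs_sub_le _ _ _
  obtain ⟨l, hl⟩ := exists_dual A (c := lpMax A C g + ε)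
    (by positivity : 0 ≤ C * √((n : ℝ) * Real.log ((m : ℝ) / (n : ℝ) + 2))) g
    (fun y h1 h2 => lt_of_le_of_lt (hmax.2 ⟨y, ⟨h1, h2⟩, rfl⟩) (by linarith))
  have hq : 0 ≤ (n : ℝ) / a * ∑ j, g j ^ 2 := by positivity
  rcases le_or_gt (C * √((n : ℝ) * Real.log ((m : ℝ) / (n : ℝ) + 2)) * ∑ i, |l i|) a with h | h
  · obtain ⟨s, hs⟩ := hv l h
    refine ⟨s, ?_⟩
    have h1 := tri (fun j => ∑ i, l i * A i j) s
    have h2 : 0 ≤ C * √((n : ℝ) * Real.log ((m : ℝ) / (n : ℝ) + 2)) * ∑ i, |l i| := by positivity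
    linarith
  -- Here the dual cost alone exceeds `a`, so the net point near `0` serves: `‖g‖₁ ≤ a + ‖g‖₁² / a`,
  -- and Cauchy–Schwarz bounds the last term.
  · obtain ⟨s, hs⟩ := hv 0 (by simpa using ha.le)
    refine ⟨s, ?_⟩
    have h1 := tri 0 s
    have h2 : 0 ≤ ∑ j, |g j - ∑ i, l i * A i j| := by positivity
    have h3 : ∑ j, |g j| ≤ a + n / a * ∑ j, g j ^ 2 := by
      have h4 := sq_sum_abs_le g
      set G := ∑ j, |g j|
      have h5 : G ≤ a + G ^ 2 / a := by
        rw [← sub_nonneg]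
        have : a + G ^ 2 / a - G = ((a - G / 2) ^ 2 + 3 / 4 * G ^ 2) / a := by field_simp; ring
        rw [this]
        positivity
      have h6 : G ^ 2 / a ≤ n / a * ∑ j, g j ^ 2 := by
        rw [div_mul_eq_mul_div]
        gcongr
      linarith
    simp only [Pi.zero_apply, sub_zero, zero_mul, Finset.sum_const_zero] at h1 hs
    linarith

/-- Soft-min union bound: `‖g - v s‖₁ ≥ -log (S g) / θ` for every `s`. The tangent to `log` at `c₀`,
an upper bound for the mean of `S`, makes this linear in `S` before integrating. -/
theorem le_integral_lpMax_of_net {m n : ℕ} (A : Matrix (Fin m) (Fin n) ℝ) {C : ℝ} (hC : 0 ≤ C)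
    {σ : Type*} [Fintype σ] (v : σ → Fin n → ℝ) {a e θ : ℝ} (ha : 0 < a) (hθ : 0 < θ)
    (hv : ∀ l : Fin m → ℝ, C * √((n : ℝ) * Real.log ((m : ℝ) / (n : ℝ) + 2)) * ∑ i, |l i| ≤ a →
      ∃ s, ∑ j, |∑ i, l i * A i j - v s j| ≤ e) :
    n * √(2 / Real.pi) - n * θ - Real.log (Fintype.card σ) / θ - e - n ^ 2 / a
      ≤ ∫ g, lpMax A C g ∂(gauss n) := by
  have : IsProbabilityMeasure (gauss n) := by unfold gauss; infer_instance
  have hne : Nonempty σ := by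
    obtain ⟨s, _⟩ := hv 0 (by simpa using ha.le)
    exact ⟨s⟩
  have hcard : (0 : ℝ) < Fintype.card σ := Nat.cast_pos.2 Fintype.card_pos
  set c₀ : ℝ := Fintype.card σ * Real.exp (n * (-θ * √(2 / Real.pi) + θ ^ 2)) with hc₀
  have hc₀pos : 0 < c₀ := by positivity
  set S : (Fin n → ℝ) → ℝ := fun g => ∑ s, Real.exp (-θ * ∑ j, |g j - v s j|) with hS
  have hSint : Integrable S (gauss n) := integrable_sum_exp v hθ.le
  have hSle : ∫ g, S g ∂(gauss n) ≤ c₀ := integral_sum_exp_le v hθ.le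
  have hpt : ∀ g, (1 - Real.log c₀) / θ - e - 1 / (c₀ * θ) * S g - n / a * ∑ j, g j ^ 2
      ≤ lpMax A C g := by
    intro g
    refine le_of_forall_pos_le_add fun ε hε => ?_
    obtain ⟨s, hs⟩ := exists_net_point_le_lpMax A hC v ha hv g hε
    have h1 : Real.exp (-θ * ∑ j, |g j - v s j|) ≤ S g :=
      Finset.single_le_sum (f := fun s => Real.exp (-θ * ∑ j, |g j - v s j|))
        (fun _ _ => (Real.exp_pos _).le) (Finset.mem_univ s)
    have hSpos : 0 < S g := (Real.exp_pos _).trans_le h1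
    have h2 : -θ * ∑ j, |g j - v s j| ≤ Real.log (S g) :=
      (Real.le_log_iff_exp_le hSpos).2 h1
    have h3 := Real.log_le_sub_one_of_pos (div_pos hSpos hc₀pos)
    rw [Real.log_div hSpos.ne' hc₀pos.ne'] at h3
    have h4 : (1 - Real.log c₀ - S g / c₀) / θ ≤ ∑ j, |g j - v s j| := by
      rw [div_le_iff₀ hθ]
      linarith
    have h5 : (1 - Real.log c₀ - S g / c₀) / θ = (1 - Real.log c₀) / θ - 1 / (c₀ * θ) * S g := by
      field_simp
    linarith
  have hi1 : Integrable (fun g => (1 - Real.log c₀) / θ - e - 1 / (c₀ * θ) * S g) (gauss n) :=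
    (integrable_const _).sub (hSint.const_mul _)
  have hi2 := (integrable_sum_sq n).const_mul ((n : ℝ) / a)
  have hmono := integral_mono (hi1.sub hi2) (integrable_lpMax A hC) hpt
  rw [integral_sub' hi1 hi2, integral_sub (integrable_const _) (hSint.const_mul _),
    integral_const_mul, integral_const_mul, integral_sum_sq, integral_const] at hmono
  simp only [probReal_univ, one_smul] at hmono
  refine le_trans ?_ hmono
  have h1 : 1 / (c₀ * θ) * ∫ g, S g ∂(gauss n) ≤ 1 / θ := by
    calc 1 / (c₀ * θ) * ∫ g, S g ∂(gauss n) ≤ 1 / (c₀ * θ) * c₀ := by gcongr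
      _ = 1 / θ := by field_simp
  have h2 : Real.log c₀ = Real.log (Fintype.card σ) + n * (-θ * √(2 / Real.pi) + θ ^ 2) := by
    rw [hc₀, Real.log_mul hcard.ne' (Real.exp_pos _).ne', Real.log_exp]
  have h3 : (1 - Real.log c₀) / θ
      = 1 / θ - Real.log (Fintype.card σ) / θ + n * √(2 / Real.pi) - n * θ := by
    rw [h2]
    field_simp
    ring
  have h4 : (n : ℝ) / a * n = n ^ 2 / a := by ring
  linarith

/-- The cost constraint forces `‖l‖₁ ≤ R = n / (p³ w)`. Maurey's squared error `4R²n / max k 1` is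
then at most `8n / p²`, and Cauchy–Schwarz turns it into `ℓ¹` error `√8 n / p ≤ 3n / p`. -/
theorem exists_net {m n : ℕ} (hn : 0 < n) (A : Matrix (Fin m) (Fin n) ℝ)
    (hA : ∀ i j, |A i j| ≤ 1) {p : ℝ} (hp : 1 ≤ p) {k : ℕ}
    (hk : k = ⌊(n : ℝ) / (p ^ 4 * Real.log ((m : ℝ) / n + 2))⌋₊) :
    ∃ v : Sym (Option (Fin m × Bool)) k → Fin n → ℝ, ∀ l : Fin m → ℝ,
      p ^ 4 * √((n : ℝ) * Real.log ((m : ℝ) / (n : ℝ) + 2)) * ∑ i, |l i| ≤ p * n →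
      ∃ s, ∑ j, |∑ i, l i * A i j - v s j| ≤ 3 * n / p := by
  have hn' : (0 : ℝ) < n := Nat.cast_pos.2 hn
  have hp0 : 0 < p := by linarith
  have hℓ : 0 < Real.log ((m : ℝ) / n + 2) := by
    linarith [half_le_log (by positivity : 0 ≤ (m : ℝ) / n)]
  set ℓ := Real.log ((m : ℝ) / n + 2)
  set w : ℝ := √((n : ℝ) * ℓ) with hw
  have hw0 : 0 < w := Real.sqrt_pos.2 (by positivity)
  have hw2 : w ^ 2 = n * ℓ := Real.sq_sqrt (by positivity)
  set R : ℝ := n / (p ^ 3 * w) with hR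
  have hR0 : 0 < R := by positivity
  let a : Fin m → EuclideanSpace ℝ (Fin n) := fun i => WithLp.toLp 2 (A i)
  have ha : ∀ i, ‖a i‖ ≤ √(n : ℝ) := by
    intro i
    rw [EuclideanSpace.norm_eq]
    refine Real.sqrt_le_sqrt ?_
    calc ∑ j, ‖a i j‖ ^ 2 ≤ ∑ _j : Fin n, (1 : ℝ) := by
          refine Finset.sum_le_sum fun j _ => pow_le_one₀ (norm_nonneg _) ?_
          exact hA i j
      _ = n := by simp
  refine ⟨fun s => ((R / k) • ((s : Multiset _).map (signedFamily a)).sum :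
    EuclideanSpace ℝ (Fin n)), fun l hl => ?_⟩
  have hlR : ∑ i, |l i| ≤ R := by
    rw [hR, le_div_iff₀ (by positivity)]
    have : p * ((∑ i, |l i|) * (p ^ 3 * w)) ≤ p * n := by linarith
    exact le_of_mul_le_mul_left this hp0
  obtain ⟨s, hs⟩ := exists_sym_average_close (Real.sqrt_nonneg (n : ℝ)) hR0 ha hlR k
  refine ⟨s, ?_⟩
  set z := (R / k) • ((s : Multiset _).map (signedFamily a)).sum
  have h1 : ‖∑ i, l i • a i - z‖ ^ 2 = ∑ j, (∑ i, l i * A i j - z j) ^ 2 := by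
    rw [EuclideanSpace.real_norm_sq_eq]
    simp [a]
  have hmax : 0 < max (k : ℝ) 1 := by positivity
  have h2 : 4 * R ^ 2 * √(n : ℝ) ^ 2 / max (k : ℝ) 1 ≤ 8 * n / p ^ 2 := by
    rw [div_le_iff₀ hmax, Real.sq_sqrt hn'.le]
    have h3 : (n : ℝ) / (p ^ 4 * ℓ) / 2 ≤ max (k : ℝ) 1 := hk ▸ half_le_max_floor
    calc 4 * R ^ 2 * n = 8 * n / p ^ 2 * ((n : ℝ) / (p ^ 4 * ℓ) / 2) := by
          rw [hR, div_pow, mul_pow, hw2]; field_simp; norm_num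
      _ ≤ _ := by gcongr
  have h4 := sq_sum_abs_le (fun j => ∑ i, l i * A i j - z j)
  rw [h1] at hs
  refine abs_le_of_sq_le_sq' (a := _) ?_ (by positivity) |>.2
  calc (∑ j, |∑ i, l i * A i j - z j|) ^ 2 ≤ n * (8 * n / p ^ 2) :=
        h4.trans (by gcongr; exact hs.trans h2)
    _ ≤ n * (9 * n / p ^ 2) := by gcongr; norm_num
    _ = (3 * n / p) ^ 2 := by field_simp; norm_num

/-! ### Choice of parameters -/

theorem OPT_nonneg {m n : ℕ} (A : Matrix (Fin m) (Fin n) ℝ) {C : ℝ} (hC : 0 ≤ C) :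
    0 ≤ OPT A C := by
  refine div_nonneg (integral_nonneg fun g => ?_) (Real.sqrt_nonneg _)
  refine (lpMax_isGreatest A hC g).2 ⟨0, ⟨?_, by simp⟩, by simp⟩
  simp only [Matrix.mulVec_zero, norm_zero]
  positivity

/-- Take `θ = 1/p` and `a = p n`. The losses from `θ`, the cardinality, the net and large dual
vectors are `n/p`, `10n/p`, `3n/p` and `n/p`, hence the 15. -/
theorem le_OPT_of_one_le {m n : ℕ} (hn : 0 < n) (A : Matrix (Fin m) (Fin n) ℝ)
    (hA : ∀ i j, |A i j| ≤ 1) {p : ℝ} (hp : 1 ≤ p) :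
    √(2 * (n : ℝ) / Real.pi) - 15 / p * √(n : ℝ) ≤ OPT A (p ^ 4) := by
  have hn' : (0 : ℝ) < n := Nat.cast_pos.2 hn
  have hp0 : 0 < p := by linarith
  obtain ⟨v, hv⟩ := exists_net hn A hA hp rfl
  have h1 := le_integral_lpMax_of_net A (by positivity : 0 ≤ p ^ 4) v
    (by positivity : 0 < p * n) (by positivity : 0 < 1 / p) hv
  have h2 := log_card_sym_le m hn hp rfl
  have hs0 : 0 < √(n : ℝ) := Real.sqrt_pos.2 hn'
  rw [OPT, le_div_iff₀ hs0]
  refine le_trans ?_ h1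
  have h3 : √(2 * (n : ℝ) / Real.pi) * √(n : ℝ) = n * √(2 / Real.pi) := by
    rw [show 2 * (n : ℝ) / Real.pi = 2 / Real.pi * n by ring, Real.sqrt_mul (by positivity),
      mul_assoc, Real.mul_self_sqrt hn'.le, mul_comm]
  have h4 := mul_le_mul_of_nonneg_right h2 hp0.le
  rw [sub_mul, h3, mul_assoc, Real.mul_self_sqrt hn'.le, div_div_eq_mul_div, div_one]
  have h5 : 10 * (n : ℝ) / p ^ 2 * p = 10 * (n / p) := by field_simp
  have h6 : (n : ℝ) ^ 2 / (p * n) = n / p := by field_simp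
  rw [h5] at h4
  rw [h6, mul_one_div, div_mul_eq_mul_div, mul_div_assoc, mul_div_assoc]
  linarith

end SpencerLP

/-- There are constants `δ' C > 0`, depending only on `C` and tending to `0` as `C → ∞`, such that
`OPT_A(C) ≥ √(2n/π) - δ'_C √n` for all matrices `A` with `‖A‖_{1→∞} ≤ 1` and all `C > 0`. -/
theorem lemma3p4 :
    ∃ δ' : ℝ → ℝ, (∀ C : ℝ, 0 < C → 0 < δ' C) ∧ Tendsto δ' atTop (𝓝 0) ∧
      ∀ (m n : ℕ), 0 < n → ∀ (A : Matrix (Fin m) (Fin n) ℝ), SpencerLP.normOneInfty A ≤ 1 →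
        ∀ C : ℝ, 0 < C →
          √(2 * (n : ℝ) / Real.pi) - δ' C * √(n : ℝ) ≤ SpencerLP.OPT A C := by
  refine ⟨fun C => 15 / √(√C), fun C hC => by positivity,
    (Real.tendsto_sqrt_atTop.comp Real.tendsto_sqrt_atTop).const_div_atTop 15, ?_⟩
  intro m n hn A hA C hC
  rcases le_total 1 C with h | h
  · have hp : 1 ≤ √(√C) := by
      rw [Real.one_le_sqrt, Real.one_le_sqrt]
      exact h
    have h4 : √(√C) ^ 4 = C := by
      rw [show √(√C) ^ 4 = (√(√C) ^ 2) ^ 2 by ring, Real.sq_sqrt (Real.sqrt_nonneg _),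
        Real.sq_sqrt hC.le]
    have := SpencerLP.le_OPT_of_one_le hn A ((SpencerLP.normOneInfty_le_one_iff A).1 hA) hp
    rwa [h4] at this
  -- For `C ≤ 1` the left side is nonpositive, as `δ' C ≥ 15` and `2/π < 1`.
  · refine le_trans ?_ (SpencerLP.OPT_nonneg A hC.le)
    have hp0 : 0 < √(√C) := by positivity
    have hp : √(√C) ≤ 1 := by
      rw [Real.sqrt_le_one, Real.sqrt_le_one]
      exact h
    have h1 : (1 : ℝ) ≤ 15 / √(√C) := by
      rw [le_div_iff₀ hp0]
      linarith
    have h2 : √(2 * (n : ℝ) / Real.pi) ≤ √(n : ℝ) := by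
      refine Real.sqrt_le_sqrt ?_
      rw [div_le_iff₀ Real.pi_pos]
      have : (0 : ℝ) ≤ n := Nat.cast_nonneg n
      nlinarith [Real.pi_gt_three]
    have h3 := mul_le_mul_of_nonneg_right h1 (Real.sqrt_nonneg (n : ℝ))
    simp only
    linarith
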